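/- All graphs are finite and simple, and $\rho(G)$ denotes the spectral radius of $G$, i.e. the largest eigenvalue of its adjacency matrix. For $n>k>0$ let $S_{n,k}^0=K_k\nabla (n-k)K_1$ be the graph of order $n$ obtained from a complete graph on $k$ vertices and an independent set of $n-k$ vertices by joining every vertex of the former to every vertex of the latter. A spider is a tree of order at least $4$ with at most one vertex of degree at least $3$; its center is the vertex of degree at least $3$ (if there is none, any vertex of degree $2$ may be taken as the center). A leg of a spider is a path from the center to a leaf, and its length is its number of edges. Let $k\ge 2$ and let $F$ be a spider of order $2k+3$ with exactly $r$ legs of odd length and exactly $s$ legs of length $1$ (the latter being counted among the former). If $r\ge 3$ and $2s-r\ge 2$, then there is an integer $N$ such that for every $n\ge N$, every graph $G$ of order $n$ with $\rho(G)\ge\rho(S_{n,k}^0)$ contains $F$ as a (not necessarily induced) subgraph. -/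

import Mathlib

namespace SpiderSpectral

open Classical in
/-- The spectral radius `ρ(G)` of a finite graph: the largest eigenvalue of its (real symmetric)
adjacency matrix. For a nonempty vertex set the spectrum is finite and nonempty, so that this
supremum is a maximum. -/
noncomputable def rho {V : Type*} [Fintype V] (G : SimpleGraph V) : ℝ :=
  sSup (spectrum ℝ (G.adjMatrix ℝ))

/-- The join `G ∇ H` of two graphs: their disjoint union together with all edges between them. -/
def join {V W : Type*} (G : SimpleGraph V) (H : SimpleGraph W) : SimpleGraph (V ⊕ W) :=
  G.sum H ⊔ completeBipartiteGraph V W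

/-- The graph `S_{n,k}^0 = K_k ∇ (n-k)K_1`, of order `n` when `k ≤ n`. -/
def splitGraph (n k : ℕ) : SimpleGraph (Fin k ⊕ Fin (n - k)) :=
  join (⊤ : SimpleGraph (Fin k)) (⊥ : SimpleGraph (Fin (n - k)))

/-- A spider: a tree of order at least 4 with at most one vertex of degree at least 3. -/
structure IsSpider {W : Type*} [Fintype W] (F : SimpleGraph W) [DecidableRel F.Adj] : Prop where
  isTree : F.IsTree
  four_le_card : 4 ≤ Fintype.card W
  branch_unique : ∀ u v : W, 3 ≤ F.degree u → 3 ≤ F.degree v → u = v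

/-- `c` is a center of the spider `F`: the vertex of degree at least 3 if there is one, and
any vertex of degree 2 otherwise. -/
def IsCenter {W : Type*} [Fintype W] (F : SimpleGraph W) [DecidableRel F.Adj] (c : W) : Prop :=
  3 ≤ F.degree c ∨ ((∀ v : W, F.degree v ≤ 2) ∧ F.degree c = 2)

/-- The legs of `F` with respect to the center `c`: the paths from `c` to a leaf,
recorded together with that leaf. -/
def legs {W : Type*} [Fintype W] (F : SimpleGraph W) [DecidableRel F.Adj] (c : W) :
    Set (Σ v : W, F.Path c v) :=
  {p | F.degree p.1 = 1}

/-- The number of legs of odd length. -/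
noncomputable def numOddLegs {W : Type*} [Fintype W] (F : SimpleGraph W) [DecidableRel F.Adj]
    (c : W) : ℕ :=
  {p ∈ legs F c | Odd (p.2 : F.Walk c p.1).length}.ncard

/-- The number of legs of length 1. -/
noncomputable def numUnitLegs {W : Type*} [Fintype W] (F : SimpleGraph W) [DecidableRel F.Adj]
    (c : W) : ℕ :=
  {p ∈ legs F c | (p.2 : F.Walk c p.1).length = 1}.ncard

end SpiderSpectral

namespace SpiderSpectral

/-! Let O be the vertices of `F` at odd distance from the center. Every edge has exactly one end in
O, vertices of O have degree at most 2, and the leaves of the odd legs have degree 1, so 2k + 2 ≤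
2|O| - r. As r ≥ 3, the other colour class has at most k vertices (`card_add_numOddLegs_le`), and
only this is needed of the spider.

Suppose that G is `F`-free. It has bounded degeneracy, since `F` would embed greedily into a
subgraph of large minimum degree, and no k vertices have |W| common neighbours, since `F` would
embed into the resulting complete bipartite graph. Then boundedly many vertices have linear degree,
and all but boundedly many vertices see at most k - 1 of them. A weighted row-sum estimate
(`rho_le_of_degenerate`) bounds ρ(G) by √((k-1)n), up to an arbitrarily small multiple of √n and a
constant. For large n this is less than √(k(n-k)), which is at most ρ of the split graph. -/

/-! ### Colour classes of a spider -/

/-- In a tree, the length of a path is the distance between its ends. -/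
theorem path_length_eq_dist {W : Type*} {F : SimpleGraph W} (hF : F.IsTree) {u v : W}
    (p : F.Path u v) : (p : F.Walk u v).length = F.dist u v := by
  obtain ⟨q, hq, hlen⟩ := (hF.connected u v).exists_path_of_dist
  have := hF.isAcyclic.subsingleton_path u v
  rw [← hlen, Subsingleton.elim p ⟨q, hq⟩]

/-- A lower bound for the number of vertices of a spider at odd distance from its center, obtained
by counting edges at these vertices: each has degree at most 2, and the odd legs end in leaves. -/
theorem card_add_numOddLegs_le {W : Type*} [Fintype W] (F : SimpleGraph W)
    [DecidableRel F.Adj] (hF : IsSpider F) {c : W} (hc : IsCenter F c) :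
    Fintype.card W + numOddLegs F c ≤
      2 * (Finset.univ.filter fun v => Odd (F.dist c v)).card + 1 := by
  classical
  set O := Finset.univ.filter fun v => Odd (F.dist c v) with hO
  set E := Finset.univ.filter fun v => ¬ Odd (F.dist c v) with hE
  have hbip : F.IsBipartiteWith (O : Set W) (E : Set W) := by
    refine ⟨?_, fun v w h => ?_⟩
    · rw [Finset.disjoint_coe]
      exact Finset.disjoint_filter_filter_not _ _ _
    · have := hF.isTree.dist_eq_dist_add_one_of_adj c h
      simp only [hO, hE, Finset.coe_filter, Finset.mem_univ, true_and, Set.mem_ofPred_eq]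
      rcases this with h | h <;> rw [h] <;> simp only [Nat.odd_add_one] <;> tauto
  have hsum := SimpleGraph.isBipartiteWith_sum_degrees_eq_card_edges hbip
  have hedges := hF.isTree.card_edgeFinset
  have hdeg : ∀ v ∈ O, F.degree v ≤ 2 := by
    intro v hv
    by_contra! h
    -- A vertex of degree at least 3 is the center, whose distance 0 to itself is even.
    rcases hc with hc | hc
    · have hvc := hF.branch_unique v c h hc
      simp [hO, hvc] at hv
    · have := hc.1 v
      omega
  set A := O.filter fun v => F.degree v = 1 with hA
  have hlegs : numOddLegs F c ≤ A.card := by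
    unfold numOddLegs
    rw [← Set.ncard_coe_finset]
    refine Set.ncard_le_ncard_of_injOn (fun p => p.1) ?_ ?_ (Finset.finite_toSet _)
    · rintro ⟨v, p⟩ ⟨h1, h2⟩
      have h3 : F.degree v = 1 := h1
      rw [path_length_eq_dist hF.isTree] at h2
      simp [hA, hO, h3, h2]
    · rintro ⟨v, p⟩ _ ⟨w, q⟩ _ (rfl : v = w)
      have := hF.isTree.isAcyclic.subsingleton_path c v
      rw [Subsingleton.elim p q]
  have hle : ∑ v ∈ O, (F.degree v + if F.degree v = 1 then 1 else 0) ≤ ∑ v ∈ O, 2 := by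
    refine Finset.sum_le_sum fun v hv => ?_
    have := hdeg v hv
    split_ifs <;> omega
  rw [Finset.sum_add_distrib, hsum, Finset.sum_const, smul_eq_mul] at hle
  have hcardA : A.card = ∑ v ∈ O, if F.degree v = 1 then 1 else 0 := Finset.card_filter _ _
  omega

/-! ### Embedding trees, and degeneracy -/

/-- A bipartite graph embeds into any graph with sufficiently many common neighbours
of sufficiently many vertices. -/
theorem isContained_of_common_neighbors {W V : Type*} [Fintype W] (F : SimpleGraph W)
    (G : SimpleGraph V) (P : W → Prop) [DecidablePred P]
    (hP : ∀ u v, F.Adj u v → (P u ↔ ¬ P v)) (S T : Finset V)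
    (hS : (Finset.univ.filter fun v => ¬ P v).card ≤ S.card)
    (hT : (Finset.univ.filter fun v => P v).card ≤ T.card)
    (hST : ∀ x ∈ S, ∀ y ∈ T, G.Adj x y) : F.IsContained G := by
  classical
  rw [← Fintype.card_subtype, ← Fintype.card_coe] at hS hT
  obtain ⟨f⟩ := Function.Embedding.nonempty_of_card_le hS
  obtain ⟨g⟩ := Function.Embedding.nonempty_of_card_le hT
  let φ : W → V := fun w => if h : P w then g ⟨w, h⟩ else f ⟨w, h⟩
  refine ⟨⟨⟨φ, ?_⟩, ?_⟩⟩
  · intro a b hab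
    have := hP a b hab
    by_cases hb : P b
    · have ha : ¬ P a := by tauto
      simp only [φ, ha, hb, dif_pos, dif_neg, not_false_eq_true]
      exact hST _ (f _).2 _ (g _).2
    · have ha : P a := by tauto
      simp only [φ, ha, hb, dif_pos, dif_neg, not_false_eq_true]
      exact (hST _ (f _).2 _ (g _).2).symm
  · intro a b hab
    have hab' : φ a = φ b := hab
    by_cases ha : P a <;> by_cases hb : P b <;>
      simp only [φ, ha, hb, dif_pos, dif_neg, not_false_eq_true] at hab'
    · simpa using g.injective (Subtype.ext hab')
    · exact absurd hab' (hST _ (f _).2 _ (g _).2).ne'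
    · exact absurd hab' (hST _ (f _).2 _ (g _).2).ne
    · simpa using f.injective (Subtype.ext hab')

/-- A tree embeds greedily into a nonempty vertex set in which all degrees are at least
the order of the tree. -/
theorem isTree_exists_copy_mem {V : Type*} [DecidableEq V] (G : SimpleGraph V)
    [DecidableRel G.Adj] (S : Finset V) (hS : S.Nonempty) (n : ℕ) :
    ∀ {W : Type*} [Fintype W] (F : SimpleGraph W), F.IsTree → Fintype.card W = n →
      (∀ v ∈ S, n ≤ (S.filter (G.Adj v)).card) →
      ∃ φ : W → V, Function.Injective φ ∧ (∀ a b, F.Adj a b → G.Adj (φ a) (φ b)) ∧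
        ∀ a, φ a ∈ S := by
  classical
  induction n with
  | zero =>
    intro W _ F hF hW _
    have := hF.connected.nonempty
    exact absurd hW Fintype.card_ne_zero
  | succ n ih =>
    intro W _ F hF hW hd
    rcases subsingleton_or_nontrivial W with hW1 | hW1
    · obtain ⟨s, hs⟩ := hS
      refine ⟨fun _ => s, fun a b _ => Subsingleton.elim a b, fun a b h => ?_, fun _ => hs⟩
      exact absurd (Subsingleton.elim a b) h.ne
    obtain ⟨v, hv⟩ := hF.exists_vert_degree_one_of_nontrivial
    have hT : (F.induce {v}ᶜ).IsTree :=
      ⟨hF.connected.induce_compl_singleton_of_degree_eq_one hv, hF.isAcyclic.induce _⟩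
    obtain ⟨u, hu, huniq⟩ := SimpleGraph.degree_eq_one_iff_existsUnique_adj.mp hv
    have hcard : Fintype.card ({v}ᶜ : Set W) = n := by
      rw [Fintype.card_compl_set, hW]; simp
    obtain ⟨ψ, hinj, hadj, hmem⟩ := ih (F.induce {v}ᶜ) hT hcard
      fun x hx => (Nat.le_succ n).trans (hd x hx)
    have huv : u ∈ ({v}ᶜ : Set W) := hu.ne'
    -- The image of `u` has at least `n + 1` neighbours in `S`, and the copy built so far occupies
    -- only `n` vertices.
    obtain ⟨y, hy, hyψ⟩ : ∃ y ∈ S.filter (G.Adj (ψ ⟨u, huv⟩)), y ∉ Finset.univ.image ψ := by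
      apply Finset.exists_mem_notMem_of_card_lt_card
      rw [Finset.card_image_of_injective _ hinj, Finset.card_univ, hcard]
      exact hd _ (hmem _)
    have hyψ' : ∀ a, ψ a ≠ y := by simpa using hyψ
    rw [Finset.mem_filter] at hy
    refine ⟨fun w => if h : w = v then y else ψ ⟨w, h⟩, ?_, ?_, ?_⟩
    · intro a b hab
      by_cases ha : a = v <;> by_cases hb : b = v <;> simp only [ha, hb, dif_pos, dif_neg,
        not_false_eq_true] at hab ⊢
      · exact absurd hab.symm (hyψ' _)
      · exact absurd hab (hyψ' _)
      · exact congrArg Subtype.val (hinj hab)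
    · intro a b hab
      by_cases ha : a = v <;> by_cases hb : b = v <;> simp only [ha, hb, dif_pos, dif_neg,
        not_false_eq_true]
      · exact absurd (ha.trans hb.symm) hab.ne
      · subst ha
        obtain rfl := huniq b hab
        exact hy.2.symm
      · subst hb
        obtain rfl := huniq a hab.symm
        exact hy.2
      · exact hadj _ _ hab
    · intro a
      by_cases ha : a = v
      · simp [ha, hy.1]
      · simp [ha, hmem]

/-- If every nonempty vertex set has a vertex with at most `d` neighbours inside, the vertices
can be ordered so that each has at most `d` later neighbours. -/
theorem exists_degenerate_order {V : Type*} [DecidableEq V] (G : SimpleGraph V)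
    [DecidableRel G.Adj] (d : ℕ)
    (h : ∀ S : Finset V, S.Nonempty → ∃ v ∈ S, (S.filter (G.Adj v)).card ≤ d) (S : Finset V) :
    ∃ f : V → ℕ, Set.InjOn f S ∧
      ∀ v ∈ S, (S.filter fun u => G.Adj v u ∧ f v < f u).card ≤ d := by
  induction S using Finset.strongInduction with
  | H S ih =>
    rcases S.eq_empty_or_nonempty with rfl | hS
    · exact ⟨fun _ => 0, by simp, by simp⟩
    obtain ⟨v, hv, hvd⟩ := h S hS
    obtain ⟨f, hf, hfd⟩ := ih _ (Finset.erase_ssubset hv)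
    -- The vertex of small degree goes first; the order on the rest is shifted up by one to make
    -- room.
    refine ⟨fun u => if u = v then 0 else f u + 1, ?_, ?_⟩
    · intro a ha b hb hab
      by_cases ha' : a = v <;> by_cases hb' : b = v <;> simp [ha', hb'] at hab ⊢
      exact hf (by simp_all) (by simp_all) hab
    · intro u hu
      by_cases huv : u = v
      · subst huv
        exact (Finset.card_le_card (Finset.monotone_filter_right _ fun w _ hw => hw.1)).trans hvd
      · refine (Finset.card_le_card ?_).trans (hfd u (Finset.mem_erase.2 ⟨huv, hu⟩))
        intro w hw
        rw [Finset.mem_filter] at hw ⊢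
        obtain ⟨hwS, hadj, hlt⟩ := hw
        by_cases hwv : w = v
        · simp [hwv] at hlt
        · simp [hwv, huv] at hlt
          exact ⟨Finset.mem_erase.2 ⟨hwv, hwS⟩, hadj, hlt⟩

/-! ### Bounds for the spectral radius -/

open Classical in
/-- Weighted row-sum bound for the spectral radius. -/
theorem rho_le_of_weights {V : Type*} [Fintype V] (G : SimpleGraph V) (w : V → V → ℝ) (B : ℝ)
    (hB : 0 ≤ B) (hpos : ∀ u v, 0 < w u v) (hw : ∀ u v, G.Adj u v → 1 ≤ w u v * w v u)
    (hrow : ∀ u, ∑ v, (if G.Adj u v then w u v else 0) ≤ B) : rho G ≤ B := by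
  -- `hB` is required because the supremum of an empty set of reals is 0.
  refine Real.sSup_le (fun μ hμ => ?_) hB
  rw [← Matrix.spectrum_toLin', ← Module.End.hasEigenvalue_iff_mem_spectrum] at hμ
  obtain ⟨x, hx⟩ := hμ.exists_hasEigenvector
  have hx0 : x ≠ 0 := hx.2
  have hAx : ∀ u, ∑ v, (if G.Adj u v then x v else 0) = μ * x u := by
    intro u
    have h1 := congrFun hx.apply_eq_smul u
    simpa [Matrix.toLin'_apply, Matrix.mulVec, dotProduct, SimpleGraph.adjMatrix_apply] using h1
  have hxpos : 0 < ∑ u, x u ^ 2 := by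
    obtain ⟨u, hu⟩ := Function.ne_iff.1 hx0
    exact Finset.sum_pos' (fun _ _ => sq_nonneg _) ⟨u, Finset.mem_univ _, by
      simpa using sq_pos_of_ne_zero hu⟩
  have hquad : 2 * ∑ u, ∑ v, (if G.Adj u v then x u * x v else 0) = 2 * μ * ∑ u, x u ^ 2 := by
    rw [mul_assoc, Finset.mul_sum (a := μ)]
    congr 1
    refine Finset.sum_congr rfl fun u _ => ?_
    have h2 := congrArg (x u * ·) (hAx u)
    simp only [Finset.mul_sum, mul_ite, mul_zero] at h2
    rw [h2]; ring
  have hle : 2 * ∑ u, ∑ v, (if G.Adj u v then x u * x v else 0) ≤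
      ∑ u, ∑ v, ((if G.Adj u v then w u v else 0) * x u ^ 2
        + (if G.Adj v u then w v u else 0) * x v ^ 2) := by
    rw [Finset.mul_sum]
    refine Finset.sum_le_sum fun u _ => ?_
    rw [Finset.mul_sum]
    refine Finset.sum_le_sum fun v _ => ?_
    by_cases h : G.Adj u v
    · simp only [h, h.symm, if_true]
      have h1 := hw u v h
      have hp := hpos u v
      have hq := hpos v u
      -- Weighted AM-GM: 2 x_u x_v ≤ w_uv x_u² + x_v² / w_uv, and 1 / w_uv ≤ w_vu.
      have h3 : 0 ≤ (w u v * x u - x v) ^ 2 := sq_nonneg _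
      have h4 : x v ^ 2 ≤ w u v * w v u * x v ^ 2 := le_mul_of_one_le_left (sq_nonneg _) h1
      have h5 : w u v * (2 * (x u * x v)) ≤ w u v * (w u v * x u ^ 2 + w v u * x v ^ 2) := by
        nlinarith
      exact le_of_mul_le_mul_left h5 hp
    · have h' : ¬ G.Adj v u := fun h' => h h'.symm
      simp [h, h']
  have hsum : ∑ u, ∑ v, ((if G.Adj u v then w u v else 0) * x u ^ 2
        + (if G.Adj v u then w v u else 0) * x v ^ 2) ≤ 2 * B * ∑ u, x u ^ 2 := by
    have h1 : ∑ u, ∑ v, (if G.Adj u v then w u v else 0) * x u ^ 2 ≤ B * ∑ u, x u ^ 2 := by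
      rw [Finset.mul_sum]
      refine Finset.sum_le_sum fun u _ => ?_
      rw [← Finset.sum_mul]
      exact mul_le_mul_of_nonneg_right (hrow u) (sq_nonneg _)
    simp only [Finset.sum_add_distrib]
    rw [Finset.sum_comm (f := fun u v => (if G.Adj v u then w v u else 0) * x v ^ 2)]
    linarith
  have := hquad ▸ (hle.trans hsum)
  have := le_of_mul_le_mul_right this hxpos
  linarith

open Classical in
/-- An eigenvalue is a lower bound for the spectral radius. -/
theorem le_rho_of_eigenvector {V : Type*} [Fintype V] (G : SimpleGraph V) {μ : ℝ} {x : V → ℝ}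
    (hx0 : x ≠ 0) (hx : ∀ u, ∑ v, (if G.Adj u v then x v else 0) = μ * x u) : μ ≤ rho G := by
  refine le_csSup (Matrix.finite_spectrum _).bddAbove ?_
  rw [← Matrix.spectrum_toLin', ← Module.End.hasEigenvalue_iff_mem_spectrum]
  refine Module.End.hasEigenvalue_of_hasEigenvector (x := x) ⟨?_, hx0⟩
  rw [Module.End.mem_eigenspace_iff]
  ext u
  simpa [Matrix.toLin'_apply, Matrix.mulVec, dotProduct, SimpleGraph.adjMatrix_apply] using hx u

open Classical in
/-- A lower bound for the spectral radius of `K_k ∇ (n-k)K_1`. -/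
theorem sqrt_le_rho_splitGraph {n k : ℕ} (hk : 1 ≤ k) (hn : k < n) :
    √((k : ℝ) * (n - k)) ≤ rho (splitGraph n k) := by
  have hk' : (1 : ℝ) ≤ k := by exact_mod_cast hk
  have hn' : (k : ℝ) < n := by exact_mod_cast hn
  set D : ℝ := (k - 1) ^ 2 + 4 * (k * (n - k)) with hD
  have hprod : (0 : ℝ) ≤ k * (n - k) := mul_nonneg (by linarith) (by linarith)
  have hD0 : 0 ≤ D := by positivity
  -- The larger root of l² = (k-1)l + k(n-k); the vector equal to l on the clique and k on the
  -- independent set is an eigenvector for l.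
  set l : ℝ := ((k - 1) + √D) / 2 with hl
  have hroot : l ^ 2 = (k - 1) * l + k * (n - k) := by
    have := Real.sq_sqrt hD0
    rw [hl]
    nlinarith
  have hl0 : 0 ≤ l := by
    have := Real.sqrt_nonneg D
    rw [hl]; linarith
  have hle : √((k : ℝ) * (n - k)) ≤ l := by
    apply Real.sqrt_le_iff.2 ⟨hl0, ?_⟩
    nlinarith
  refine hle.trans (le_rho_of_eigenvector _
    (x := Sum.elim (fun _ => l) (fun _ => (k : ℝ))) (fun h0 => ?_) ?_)
  · have h1 := congrFun h0 (Sum.inl ⟨0, hk⟩)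
    simp only [Sum.elim_inl, Pi.zero_apply] at h1
    rw [h1] at hroot
    have : (0 : ℝ) < k * (n - k) := mul_pos (by linarith) (by linarith)
    linarith
  · rintro (i | j)
    · have h1 : ∀ a, (splitGraph n k).Adj (Sum.inl i) (Sum.inl a) ↔ a ≠ i := by
        simp [splitGraph, join, eq_comm]
      have h2 : ∀ a, (splitGraph n k).Adj (Sum.inl i) (Sum.inr a) := by
        simp [splitGraph, join]
      simp only [Fintype.sum_sum_type, Sum.elim_inl, Sum.elim_inr, h1, h2, if_true]
      rw [← Finset.sum_filter, Finset.filter_ne', Finset.sum_const, Finset.sum_const,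
        Finset.card_erase_of_mem (Finset.mem_univ _)]
      simp only [Finset.card_univ, Fintype.card_fin, nsmul_eq_mul, Nat.cast_sub hn.le, Nat.cast_sub hk,
        Nat.cast_one]
      linarith
    · have h1 : ∀ a, (splitGraph n k).Adj (Sum.inr j) (Sum.inl a) := by
        simp [splitGraph, join]
      have h2 : ∀ a, ¬ (splitGraph n k).Adj (Sum.inr j) (Sum.inr a) := by
        simp [splitGraph, join]
      simp [Fintype.sum_sum_type, h1, h2, mul_comm]

/-! ### Degenerate graphs without many common neighbours -/

open Classical in
/-- In a `d`-degenerate graph the sum of the degrees is at most `2 d n`. -/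
theorem sum_degree_le_of_degenerate {V : Type*} [Fintype V] (G : SimpleGraph V) {d : ℕ}
    {f : V → ℕ} (hf : Function.Injective f)
    (hfd : ∀ v, (Finset.univ.filter fun u => G.Adj v u ∧ f v < f u).card ≤ d) :
    ∑ v, (Finset.univ.filter (G.Adj v)).card ≤ 2 * d * Fintype.card V := by
  have hsplit : ∀ v, (Finset.univ.filter (G.Adj v)).card =
      (∑ u, if G.Adj v u ∧ f v < f u then 1 else 0) +
        ∑ u, if G.Adj u v ∧ f u < f v then 1 else 0 := by
    intro v
    rw [Finset.card_filter, ← Finset.sum_add_distrib]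
    refine Finset.sum_congr rfl fun u _ => ?_
    by_cases h : G.Adj v u
    · rcases lt_or_gt_of_ne (hf.ne h.ne) with h' | h' <;> simp [h, h.symm, h', h'.not_gt]
    · have h' : ¬ G.Adj u v := fun h' => h h'.symm
      simp [h, h']
  have hlater : ∑ v, ∑ u, (if G.Adj v u ∧ f v < f u then 1 else 0) ≤ d * Fintype.card V := by
    calc _ ≤ ∑ _v : V, d := Finset.sum_le_sum fun v _ => by
            rw [← Finset.card_filter]; exact hfd v
      _ = d * Fintype.card V := by simp [mul_comm]
  rw [Finset.sum_congr rfl fun v _ => hsplit v, Finset.sum_add_distrib,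
    Finset.sum_comm (f := fun v u => if G.Adj u v ∧ f u < f v then 1 else 0)]
  linarith

open Classical in
/-- If no `k` vertices have `t` common neighbours, few vertices have `k` neighbours in a
given set. -/
theorem card_filter_le_of_common_neighbors {V : Type*} [Fintype V] (G : SimpleGraph V) {k t : ℕ}
    (hcommon : ∀ S T : Finset V, S.card = k → t ≤ T.card → ∃ x ∈ S, ∃ y ∈ T, ¬ G.Adj x y)
    (L : Finset V) :
    (Finset.univ.filter fun w => k ≤ (L.filter (G.Adj w)).card).card ≤ t * 2 ^ L.card := by
  have hsub : ∀ w, ∃ S : Finset V, k ≤ (L.filter (G.Adj w)).card →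
      S ⊆ L.filter (G.Adj w) ∧ S.card = k := by
    intro w
    by_cases h : k ≤ (L.filter (G.Adj w)).card
    · obtain ⟨S, hS⟩ := Finset.exists_subset_card_eq h
      exact ⟨S, fun _ => hS⟩
    · exact ⟨∅, fun h' => absurd h' h⟩
  choose g hg using hsub
  have hcard : (L.powersetCard k).card ≤ 2 ^ L.card := by
    rw [← Finset.card_powerset]
    exact Finset.card_le_card fun S hS => by
      rw [Finset.mem_powerset]; exact (Finset.mem_powersetCard.1 hS).1
  -- Each such vertex selects k of its neighbours in `L`; vertices selecting the same set are common
  -- neighbours of it, so fibres have at most `t` elements.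
  refine (Finset.card_le_mul_card_image_of_maps_to (f := g) (t := L.powersetCard k) ?_ t ?_).trans
    (Nat.mul_le_mul_left _ hcard)
  · intro w hw
    obtain ⟨h1, h2⟩ := hg w (Finset.mem_filter.1 hw).2
    exact Finset.mem_powersetCard.2 ⟨h1.trans (Finset.filter_subset _ _), h2⟩
  · intro S hS
    by_contra! h
    obtain ⟨x, hx, y, hy, hxy⟩ := hcommon S _ (Finset.mem_powersetCard.1 hS).2 h.le
    rw [Finset.mem_filter, Finset.mem_filter] at hy
    obtain ⟨⟨-, hy1⟩, rfl⟩ := hy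
    exact hxy (Finset.mem_filter.1 ((hg y hy1).1 hx)).2.symm

open Classical in
/-- The spectral radius of a `d`-degenerate graph in which no `k` vertices have `t` common
neighbours is at most `√((k - 1) n)`, up to a small multiple of `√n` and a constant. -/
theorem rho_le_of_degenerate {V : Type*} [Fintype V] [Nonempty V] (G : SimpleGraph V)
    {d k t : ℕ} (hk : 2 ≤ k) {f : V → ℕ} (hf : Function.Injective f)
    (hfd : ∀ v, (Finset.univ.filter fun u => G.Adj v u ∧ f v < f u).card ≤ d)
    (hcommon : ∀ S T : Finset V, S.card = k → t ≤ T.card → ∃ x ∈ S, ∃ y ∈ T, ¬ G.Adj x y)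
    {e : ℝ} (he : 0 < e) :
    rho G ≤ (⌊2 * d / e ^ 2⌋₊ + t * 2 ^ ⌊2 * d / e ^ 2⌋₊ : ℕ) +
      (√(k - 1) + (d + 1) * e) * √(Fintype.card V) := by
  set n : ℝ := (Fintype.card V : ℝ) with hn
  have hn0 : 0 < n := by rw [hn]; exact_mod_cast Fintype.card_pos
  set M := ⌊2 * d / e ^ 2⌋₊ with hM
  set L := Finset.univ.filter fun v => e ^ 2 * n ≤ (Finset.univ.filter (G.Adj v)).card with hL
  set Bad := Finset.univ.filter fun w => k ≤ (L.filter (G.Adj w)).card with hBad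
  have hLM : L.card ≤ M := by
    refine Nat.le_floor ?_
    rw [le_div_iff₀ (by positivity)]
    have h1 : (L.card : ℝ) * (e ^ 2 * n) ≤ ∑ v, ((Finset.univ.filter (G.Adj v)).card : ℝ) := by
      calc (L.card : ℝ) * (e ^ 2 * n) = ∑ _v ∈ L, e ^ 2 * n := by simp
        _ ≤ ∑ v ∈ L, ((Finset.univ.filter (G.Adj v)).card : ℝ) :=
            Finset.sum_le_sum fun v hv => (Finset.mem_filter.1 hv).2
        _ ≤ _ := Finset.sum_le_sum_of_subset_of_nonneg (Finset.subset_univ _)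
            fun _ _ _ => Nat.cast_nonneg _
    have h2 : ∑ v, ((Finset.univ.filter (G.Adj v)).card : ℝ) ≤ 2 * d * n := by
      rw [hn]
      exact_mod_cast sum_degree_le_of_degenerate G hf hfd
    have h3 : (L.card : ℝ) * e ^ 2 * n ≤ 2 * d * n := by linarith
    exact le_of_mul_le_mul_right h3 hn0
  have hBadM : Bad.card ≤ t * 2 ^ M :=
    (card_filter_le_of_common_neighbors G hcommon L).trans
      (Nat.mul_le_mul_left _ (Nat.pow_le_pow_right two_pos hLM))
  have hLR : (L.card : ℝ) ≤ M := by exact_mod_cast hLM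
  have hBadR : (Bad.card : ℝ) ≤ t * 2 ^ M := by exact_mod_cast hBadM
  have hk1 : (0 : ℝ) < k - 1 := by
    have : (2 : ℝ) ≤ k := by exact_mod_cast hk
    linarith
  set b := √((k : ℝ) - 1) with hb
  set m := √n with hm
  have hb0 : 0 < b := Real.sqrt_pos.2 hk1
  have hm0 : 0 < m := Real.sqrt_pos.2 hn0
  have hbb : b * b = k - 1 := Real.mul_self_sqrt hk1.le
  have hmm : m * m = n := Real.mul_self_sqrt hn0.le
  -- `p` balances n/p, the cost of a row in `L`, against (k-1)p, the cost of the neighbours in `L`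
  -- of a vertex outside `L` and `Bad`; both equal √((k-1)n).
  set p := m / b with hp
  -- For a vertex outside `L`, at most d later neighbours cost d·a, and the degree bound e²n limits
  -- the cost of the earlier ones to e²n/a = e√n.
  set a := e * m with ha
  have hp0 : 0 < p := by positivity
  have ha0 : 0 < a := by positivity
  have hnp : n * p⁻¹ = b * m := by
    rw [hp, ← hmm]; field_simp
  have hkp : (k - 1) * p = b * m := by
    rw [hp, ← hbb]; field_simp
  have hea : e ^ 2 * n * a⁻¹ = e * m := by
    rw [ha, ← hmm]; field_simp
  push_cast
  -- Weight 1 is affordable inside `L` and between `L` and `Bad`, as both sets have bounded size.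
  refine rho_le_of_weights G (fun u v =>
    if u ∈ L then (if v ∈ L ∨ v ∈ Bad then 1 else p⁻¹)
    else if v ∈ L then (if u ∈ Bad then 1 else p)
    else if f u < f v then a else a⁻¹) _ (by positivity) ?_ ?_ ?_
  · intro u v
    split_ifs <;> positivity
  · intro u v huv
    have hne := hf.ne huv.ne
    by_cases hu : u ∈ L <;> by_cases hv : v ∈ L
    · simp [hu, hv]
    · by_cases hvB : v ∈ Bad <;> simp [hu, hv, hvB, hp0.ne']
    · by_cases huB : u ∈ Bad <;> simp [hu, hv, huB, hp0.ne']
    · rcases lt_or_gt_of_ne hne with h | h <;> simp [hu, hv, h, h.not_gt, ha0.ne']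
  · intro u
    by_cases hu : u ∈ L
    · calc _ ≤ ∑ v, ((if v ∈ L then (1 : ℝ) else 0) + (if v ∈ Bad then 1 else 0) + p⁻¹) := by
            refine Finset.sum_le_sum fun v _ => ?_
            have : 0 < p⁻¹ := by positivity
            simp only [hu, if_true]
            by_cases h1 : G.Adj u v <;> by_cases h2 : v ∈ L <;> by_cases h3 : v ∈ Bad <;>
              simp [h1, h2, h3] <;> linarith
        _ = L.card + Bad.card + n * p⁻¹ := by
            simp [Finset.sum_add_distrib, hn]
        _ ≤ _ := by
            rw [hnp]
            have : 0 ≤ (d + 1) * e * m := by positivity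
            linarith
    · have hdeg : ((Finset.univ.filter (G.Adj u)).card : ℝ) ≤ e ^ 2 * n := by
        by_contra! h
        exact hu (Finset.mem_filter.2 ⟨Finset.mem_univ _, h.le⟩)
      set q : ℝ := if u ∈ Bad then 1 else p with hq
      have hq0 : 0 < q := by rw [hq]; split_ifs <;> positivity
      have hLq : ((L.filter (G.Adj u)).card : ℝ) * q ≤ M + b * m := by
        by_cases huB : u ∈ Bad
        · have h1 : ((L.filter (G.Adj u)).card : ℝ) ≤ L.card := by
            exact_mod_cast Finset.card_filter_le _ _
          have h2 : 0 ≤ b * m := by positivity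
          simp only [hq, huB, if_true]
          linarith
        · have h1 : (L.filter (G.Adj u)).card + 1 ≤ k := by
            by_contra! h
            exact huB (Finset.mem_filter.2 ⟨Finset.mem_univ _, by omega⟩)
          have h2 : ((L.filter (G.Adj u)).card : ℝ) ≤ k - 1 := by
            have : ((L.filter (G.Adj u)).card : ℝ) + 1 ≤ k := by exact_mod_cast h1
            linarith
          simp only [hq, huB, if_false]
          have h3 := mul_le_mul_of_nonneg_right h2 hp0.le
          have h4 : (0 : ℝ) ≤ M := Nat.cast_nonneg _
          linarith
      calc _ ≤ ∑ v, ((if v ∈ L ∧ G.Adj u v then q else 0)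
              + (if G.Adj u v ∧ f u < f v then a else 0) + (if G.Adj u v then a⁻¹ else 0)) := by
            refine Finset.sum_le_sum fun v _ => ?_
            have : 0 < a⁻¹ := by positivity
            by_cases h1 : G.Adj u v <;> by_cases h2 : v ∈ L <;> by_cases h3 : f u < f v <;>
              simp [hu, h1, h2, h3] <;> linarith
        _ = (L.filter (G.Adj u)).card * q
              + (Finset.univ.filter fun v => G.Adj u v ∧ f u < f v).card * a
              + (Finset.univ.filter (G.Adj u)).card * a⁻¹ := by
            have hLf : L.filter (G.Adj u) = Finset.univ.filter fun v => v ∈ L ∧ G.Adj u v := by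
              ext v; simp
            rw [hLf]
            simp only [Finset.sum_add_distrib, ← Finset.sum_filter, Finset.sum_const, nsmul_eq_mul]
        _ ≤ (M + b * m) + d * a + e ^ 2 * n * a⁻¹ := by
            have h1 : ((Finset.univ.filter fun v => G.Adj u v ∧ f u < f v).card : ℝ) ≤ d := by
              exact_mod_cast hfd u
            gcongr
        _ ≤ _ := by
            rw [hea, ha]
            have : (0 : ℝ) ≤ t * 2 ^ M := by positivity
            linarith

/-! ### Comparison for large n and conclusion -/

/-- For large `n`, the bound of `rho_le_of_degenerate` is below `√(k (n - k))`. -/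
theorem exists_forall_lt_sqrt {k : ℕ} (hk : 2 ≤ k) (C : ℝ) :
    ∃ N : ℕ, ∀ n : ℕ, N ≤ n →
      C + (√(k - 1) + (√k - √(k - 1)) / 2) * √n < √((k : ℝ) * (n - k)) := by
  have hk' : (2 : ℝ) ≤ k := by exact_mod_cast hk
  set δ := √(k : ℝ) - √(k - 1) with hδ
  have hδ0 : 0 < δ := sub_pos.2 (Real.sqrt_lt_sqrt (by linarith) (by linarith))
  -- Half of the gap, δ√n/2, must exceed |C| plus the loss of at most k in √(k(n-k)) ≥ √k·√n - k.
  obtain ⟨N, hN⟩ := exists_nat_gt ((2 * (|C| + k) / δ) ^ 2)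
  refine ⟨max N k, fun n hn => ?_⟩
  have hNn : (N : ℝ) ≤ n := by exact_mod_cast (le_max_left _ _).trans hn
  have hkn : (k : ℝ) ≤ n := by exact_mod_cast (le_max_right _ _).trans hn
  have hlarge : 2 * (|C| + k) / δ < √n := Real.lt_sqrt_of_sq_lt (hN.trans_le hNn)
  rw [div_lt_iff₀ hδ0] at hlarge
  have hC := le_abs_self C
  have hkm : (k : ℝ) ≤ √k * √n := by
    calc (k : ℝ) = √k * √k := (Real.mul_self_sqrt (by linarith)).symm
      _ ≤ √k * √n := by gcongr
  have hlow : √k * √n - k ≤ √((k : ℝ) * (n - k)) := by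
    apply Real.le_sqrt_of_sq_le
    have h1 : (√(k : ℝ) * √n) ^ 2 = k * n := by
      rw [mul_pow, Real.sq_sqrt (by linarith), Real.sq_sqrt (by linarith)]
    nlinarith
  have hsplit : √(k : ℝ) = √(k - 1) + δ := by rw [hδ]; ring
  have : (√(k - 1) + δ / 2) * √n = √k * √n - δ / 2 * √n := by rw [hsplit]; ring
  linarith

/-- A tree one of whose colour classes, seen from some vertex, has at most `k ≥ 2` vertices is
contained in every large graph whose spectral radius is at least that of `K_k ∇ (n-k)K_1`. -/
theorem isTree_isContained_of_rho_splitGraph_le {W : Type*} [Fintype W] (F : SimpleGraph W)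
    (hF : F.IsTree) (c : W) {k : ℕ} (hk : 2 ≤ k)
    (hclass : (Finset.univ.filter fun v => ¬ Odd (F.dist c v)).card ≤ k) :
    ∃ N : ℕ, ∀ n : ℕ, N ≤ n → ∀ (V : Type*) [Fintype V] (G : SimpleGraph V),
      Fintype.card V = n → rho (splitGraph n k) ≤ rho G → F.IsContained G := by
  classical
  set t := Fintype.card W with ht
  -- Chosen so that the error (t+1)e is half the gap between √k and √(k-1).
  set e : ℝ := (√k - √(k - 1)) / 2 / (t + 1) with he
  have he0 : 0 < e := by
    have hk' : (2 : ℝ) ≤ k := by exact_mod_cast hk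
    have := Real.sqrt_lt_sqrt (x := (k : ℝ) - 1) (y := k) (by linarith) (by linarith)
    have : 0 < √(k : ℝ) - √(k - 1) := sub_pos.2 this
    positivity
  obtain ⟨N, hN⟩ := exists_forall_lt_sqrt hk
    ((⌊2 * t / e ^ 2⌋₊ + t * 2 ^ ⌊2 * t / e ^ 2⌋₊ : ℕ) : ℝ)
  refine ⟨max N (k + 1), fun n hn V _ G hV hrho => ?_⟩
  have hNn : N ≤ n := (le_max_left _ _).trans hn
  have hkn : k < n := (le_max_right _ _).trans hn
  have : Nonempty V := Fintype.card_pos_iff.1 (by omega)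
  by_contra hfree
  obtain ⟨f, hf, hfd⟩ := exists_degenerate_order G t (fun S hS => by
    by_contra! h
    obtain ⟨φ, hinj, hadj, -⟩ := isTree_exists_copy_mem G S hS t F hF ht.symm
      fun v hv => (h v hv).le
    exact hfree ⟨⟨⟨φ, fun {a b} h => hadj a b h⟩, hinj⟩⟩) Finset.univ
  have hcommon : ∀ S T : Finset V, S.card = k → t ≤ T.card → ∃ x ∈ S, ∃ y ∈ T, ¬ G.Adj x y := by
    intro S T hS hT
    by_contra! h
    refine hfree (isContained_of_common_neighbors F G (fun v => Odd (F.dist c v)) ?_ S T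
      (hclass.trans hS.ge) ((Finset.card_filter_le _ _).trans hT) h)
    intro u v huv
    rcases hF.dist_eq_dist_add_one_of_adj c huv with h | h <;> rw [h, Nat.odd_add_one] <;> tauto
  have hupper := rho_le_of_degenerate G hk (by simpa [Set.injOn_univ] using hf)
    (fun v => hfd v (Finset.mem_univ _)) hcommon he0
  have hlower := sqrt_le_rho_splitGraph (by omega : 1 ≤ k) hkn
  have hte : ((t : ℝ) + 1) * e = (√k - √(k - 1)) / 2 := by
    rw [he]; field_simp
  rw [hV, hte] at hupper
  exact absurd (hlower.trans (hrho.trans hupper)) (hN n hNn).not_ge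

end SpiderSpectral

theorem corollary1p1 {W : Type*} [Fintype W] (F : SimpleGraph W) [DecidableRel F.Adj]
    (k r s : ℕ) (hk : 2 ≤ k)
    (hF : SpiderSpectral.IsSpider F) (hcard : Fintype.card W = 2 * k + 3)
    (c : W) (hc : SpiderSpectral.IsCenter F c)
    (hr : SpiderSpectral.numOddLegs F c = r) (hs : SpiderSpectral.numUnitLegs F c = s)
    (hr3 : 3 ≤ r) (hrs : (2 : ℤ) ≤ 2 * (s : ℤ) - (r : ℤ)) :
    ∃ N : ℕ, ∀ n : ℕ, N ≤ n → ∀ (V : Type*) [Fintype V] (G : SimpleGraph V),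
      Fintype.card V = n →
      SpiderSpectral.rho (SpiderSpectral.splitGraph n k) ≤ SpiderSpectral.rho G →
      F.IsContained G := by
  refine SpiderSpectral.isTree_isContained_of_rho_splitGraph_le F hF.isTree c hk ?_
  have h1 := SpiderSpectral.card_add_numOddLegs_le F hF hc
  have h2 := Finset.card_filter_add_card_filter_not (s := Finset.univ)
    (fun v => Odd (F.dist c v))
  rw [Finset.card_univ] at h2
  -- With O the odd class, 2k + 3 + r ≤ 2|O| + 1 and r ≥ 3 give |O| ≥ k + 3 by parity, leaving at
  -- most k vertices.
  omega
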